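/- Let $J\subseteq\mathbb R$ be an interval with $0\in J$, and let $f$ be a real function that is operator convex on $J$, i.e. $f$ is continuous on $J$ and $$f((1-\lambda)A+\lambda B)\le(1-\lambda)f(A)+\lambda f(B)$$ for all $\lambda\in[0,1]$ and all bounded self-adjoint operators $A,B$ on a complex Hilbert space whose spectra are contained in $J$. Suppose that $f(0)\le 0$. Let $\mathscr A$ be a unital $C^*$-algebra and let $\mathscr X$ be a (right) Hilbert $C^*$-module over $\mathscr A$, i.e. a complex vector space and right $\mathscr A$-module with an $\mathscr A$-valued inner product $\langle\cdot,\cdot\rangle$ such that $\langle x,x\rangle\ge0$ with equality only for $x=0$, $\langle x,\lambda y+z\rangle=\lambda\langle x,y\rangle+\langle x,z\rangle$, $\langle x,ya\rangle=\langle x,y\rangle a$ and $\langle x,y\rangle^*=\langle y,x\rangle$, which is complete for the norm $\|x\|=\|\langle x,x\rangle\|^{1/2}$. Let $\mathcal L(\mathscr X)$ be the $C^*$-algebra of adjointable operators on $\mathscr X$, i.e. of the maps $T$ for which there is a map $T^*$ with $\langle Tx,y\rangle=\langle x,T^*y\rangle$ for all $x,y\in\mathscr X$. Theorem. Let $T\in\mathcal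 L(\mathscr X)$ be self-adjoint with spectrum contained in $J$. Then for every $x\in\mathscr X$ with $\|x\|\le1$ the element $\langle x,Tx\rangle$ of $\mathscr A$ is self-adjoint with spectrum contained in $J$, and $$f(\langle x,Tx\rangle)\le\langle x,f(T)x\rangle ,$$ where $f(\langle x,Tx\rangle)\in\mathscr A$ and $f(T)\in\mathcal L(\mathscr X)$ are given by the continuous functional calculus. -/

import Mathlib

open scoped MulOpposite

universe u v

/-! ### Operator convexity -/

/-- `f` is operator convex on `J`: it is continuous on `J`, and
`f ((1 - t) A + t B) ≤ (1 - t) f(A) + t f(B)` in the Loewner order for all `t ∈ [0, 1]` and all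
bounded self-adjoint operators `A`, `B` on a complex Hilbert space with spectra in `J`. -/
def OperatorConvexOn.{w} (J : Set ℝ) (f : ℝ → ℝ) : Prop :=
  ContinuousOn f J ∧
    ∀ (H : Type w) [NormedAddCommGroup H] [InnerProductSpace ℂ H] [CompleteSpace H]
      (A B : H →L[ℂ] H) (t : ℝ), IsSelfAdjoint A → IsSelfAdjoint B →
      spectrum ℝ A ⊆ J → spectrum ℝ B ⊆ J → 0 ≤ t → t ≤ 1 →
      cfc f ((1 - t) • A + t • B) ≤ (1 - t) • cfc f A + t • cfc f B

/-! ### Right Hilbert modules over a C⋆-algebra -/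

/-- A (right) pre-Hilbert C⋆-module over `A`: a complex vector space that is a right `A`-module
(`MulOpposite.op a • x` stands for `x a`), with an `A`-valued inner product that is linear in the
second variable, and with the norm `‖x‖ = ‖⟨x, x⟩‖ ^ (1/2)`. It is a Hilbert C⋆-module over `A` when
moreover `CompleteSpace E`. The identity `lam (x a) = x (lam a) = (lam x) a` follows from the
fields, see `RightPreHilbertModule.smul_op_smul`. -/
class RightPreHilbertModule (A E : Type*) [CStarAlgebra A] [PartialOrder A]
    [NormedAddCommGroup E] [NormedSpace ℂ E] [Module Aᵐᵒᵖ E] extends Inner A E where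
  inner_self_nonneg (x : E) : 0 ≤ inner x x
  inner_self_eq_zero (x : E) : inner x x = 0 ↔ x = 0
  inner_smul_add_right (x y z : E) (lam : ℂ) :
    inner x (lam • y + z) = lam • inner x y + inner x z
  inner_op_smul_right (x y : E) (a : A) : inner x (MulOpposite.op a • y) = inner x y * a
  star_inner (x y : E) : star (inner x y) = inner y x
  norm_eq_sqrt_norm_inner_self (x : E) : ‖x‖ = Real.sqrt ‖inner x x‖

namespace RightPreHilbertModule

variable {A E : Type*} [CStarAlgebra A] [PartialOrder A]
  [NormedAddCommGroup E] [NormedSpace ℂ E] [Module Aᵐᵒᵖ E] [RightPreHilbertModule A E]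

theorem inner_add_right (x y z : E) : inner A x (y + z) = inner A x y + inner A x z := by
  simpa using inner_smul_add_right (A := A) x y z 1

theorem inner_zero_right (x : E) : inner A x (0 : E) = 0 := by
  simpa using inner_add_right (A := A) x 0 0

theorem inner_smul_right (x y : E) (c : ℂ) : inner A x (c • y) = c • inner A x y := by
  simpa [inner_zero_right] using inner_smul_add_right (A := A) x y 0 c

theorem inner_sub_right (x y z : E) : inner A x (y - z) = inner A x y - inner A x z := by
  have h := inner_add_right (A := A) x (y - z) z
  rw [sub_add_cancel] at h
  exact eq_sub_of_add_eq h.symm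

theorem inner_zero_left (x : E) : inner A (0 : E) x = 0 := by
  rw [← star_inner, inner_zero_right, star_zero]

theorem inner_add_left (x y z : E) : inner A (x + y) z = inner A x z + inner A y z := by
  rw [← star_inner, inner_add_right, star_add, star_inner, star_inner]

theorem inner_sub_left (x y z : E) : inner A (x - y) z = inner A x z - inner A y z := by
  rw [← star_inner, inner_sub_right, star_sub, star_inner, star_inner]

theorem inner_smul_left (x y : E) (c : ℂ) : inner A (c • x) y = star c • inner A x y := by
  rw [← star_inner, inner_smul_right, star_smul, star_inner]

theorem inner_op_smul_left (x y : E) (a : A) :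
    inner A (MulOpposite.op a • x) y = star a * inner A x y := by
  rw [← star_inner, inner_op_smul_right, star_mul, star_inner]

variable (A) in
theorem norm_sq_eq (x : E) : ‖x‖ ^ 2 = ‖inner A x x‖ := by
  rw [norm_eq_sqrt_norm_inner_self (A := A) x, Real.sq_sqrt (norm_nonneg _)]

variable (A) in
/-- Nondegeneracy of the inner product. -/
theorem ext_inner_left {x y : E} (h : ∀ z : E, inner A z x = inner A z y) : x = y := by
  rw [← sub_eq_zero, ← inner_self_eq_zero (A := A), inner_sub_right, h, sub_self]

theorem smul_op_smul (x : E) (a : A) (lam : ℂ) :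
    lam • MulOpposite.op a • x = MulOpposite.op (lam • a) • x ∧
      lam • MulOpposite.op a • x = MulOpposite.op a • lam • x := by
  constructor <;> apply ext_inner_left A <;> intro z <;>
    simp only [inner_smul_right, inner_op_smul_right, mul_smul_comm, smul_mul_assoc]

variable [StarOrderedRing A]

/-- The Cauchy-Schwarz inequality. -/
theorem norm_inner_le (x y : E) : ‖inner A x y‖ ≤ ‖x‖ * ‖y‖ := by
  set a : A := inner A x y with ha
  have hya : inner A y x = star a := (star_inner x y).symm
  rcases eq_or_ne x 0 with rfl | hx
  · simp [ha, inner_zero_left]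
  have hpos : 0 < ‖x‖ ^ 2 := by positivity
  have key : ‖x‖ ^ 2 • (star a * a) ≤ ‖x‖ ^ 2 • (‖x‖ ^ 2 • inner A y y) := by
    have h0 := inner_self_nonneg (A := A)
      (MulOpposite.op a • x - ((‖x‖ ^ 2 : ℝ) : ℂ) • y)
    have hle : star a * inner A x x * a ≤ ‖x‖ ^ 2 • (star a * a) := by
      rw [norm_sq_eq A]
      exact CStarAlgebra.star_left_conjugate_le_norm_smul
        (hb := (IsSelfAdjoint.of_nonneg (inner_self_nonneg x)))
    have hexp : inner A (MulOpposite.op a • x - ((‖x‖ ^ 2 : ℝ) : ℂ) • y)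
        (MulOpposite.op a • x - ((‖x‖ ^ 2 : ℝ) : ℂ) • y) =
        star a * inner A x x * a - ‖x‖ ^ 2 • (star a * a) - ‖x‖ ^ 2 • (star a * a)
          + ‖x‖ ^ 2 • (‖x‖ ^ 2 • inner A y y) := by
      simp only [inner_sub_left, inner_sub_right, inner_op_smul_left, inner_op_smul_right,
        inner_smul_left, inner_smul_right, ← ha, hya, Complex.star_def, Complex.conj_ofReal,
        mul_assoc]
      simp only [Complex.coe_smul, smul_sub, sub_mul, smul_mul_assoc, mul_assoc]
      abel
    rw [hexp] at h0
    have h1 := h0.trans (add_le_add_left (sub_le_sub_right (sub_le_sub_right hle _) _) _)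
    rw [sub_self, zero_sub, neg_add_eq_sub, sub_nonneg] at h1
    exact h1
  have key' : star a * a ≤ ‖x‖ ^ 2 • inner A y y := (smul_le_smul_iff_of_pos_left hpos).1 key
  have h2 : ‖a‖ ^ 2 ≤ (‖x‖ * ‖y‖) ^ 2 := by
    calc ‖a‖ ^ 2 = ‖star a * a‖ := by rw [CStarRing.norm_star_mul_self, sq]
      _ ≤ ‖‖x‖ ^ 2 • inner A y y‖ :=
        CStarAlgebra.norm_le_norm_of_nonneg_of_le (star_mul_self_nonneg a) key'
      _ = (‖x‖ * ‖y‖) ^ 2 := by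
        rw [norm_smul, ← norm_sq_eq A y, Real.norm_of_nonneg hpos.le, mul_pow]
  exact (pow_le_pow_iff_left₀ (norm_nonneg _) (by positivity) two_ne_zero).1 h2

theorem continuous_inner_left (y : E) : Continuous fun x : E => inner A x y := by
  refine (LipschitzWith.of_dist_le_mul (K := ‖y‖₊) fun x z => ?_).continuous
  rw [dist_eq_norm, dist_eq_norm, ← inner_sub_left, mul_comm]
  exact norm_inner_le _ _

theorem continuous_inner_right (x : E) : Continuous fun y : E => inner A x y := by
  refine (LipschitzWith.of_dist_le_mul (K := ‖x‖₊) fun y z => ?_).continuous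
  rw [dist_eq_norm, dist_eq_norm, ← inner_sub_right]
  exact norm_inner_le _ _

/-! ### The C⋆-algebra of adjointable operators -/

/-- The algebra `L(E)` of adjointable operators on `E`: the maps `T` for which there is a map `S`
with `⟨T x, y⟩ = ⟨x, S y⟩` for all `x`, `y`. When `E` is complete, every such map is automatically
linear and bounded, see `exists_adjointable_eq`. -/
def adjointable (A E : Type*) [CStarAlgebra A] [PartialOrder A]
    [NormedAddCommGroup E] [NormedSpace ℂ E] [Module Aᵐᵒᵖ E] [RightPreHilbertModule A E] :
    Subalgebra ℂ (E →L[ℂ] E) where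
  carrier := {T | ∃ S : E → E, ∀ x y : E, inner A (T x) y = inner A x (S y)}
  mul_mem' := by
    rintro T₁ T₂ ⟨S₁, h₁⟩ ⟨S₂, h₂⟩
    exact ⟨S₂ ∘ S₁, fun x y => by simp [h₁, h₂]⟩
  add_mem' := by
    rintro T₁ T₂ ⟨S₁, h₁⟩ ⟨S₂, h₂⟩
    exact ⟨S₁ + S₂, fun x y => by simp [h₁, h₂, inner_add_left, inner_add_right]⟩
  algebraMap_mem' c :=
    ⟨fun y => star c • y, fun x y => by
      simp [Algebra.algebraMap_eq_smul_one, inner_smul_left, inner_smul_right]⟩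

/-- On a Hilbert C⋆-module, every map that has an adjoint is (the underlying map of) an element of
`adjointable A E`. -/
theorem exists_adjointable_eq [CompleteSpace E] (T S : E → E)
    (h : ∀ x y : E, inner A (T x) y = inner A x (S y)) :
    ∃ T' : adjointable A E, ∀ x, (T' : E →L[ℂ] E) x = T x := by
  have h' : ∀ x y : E, inner A y (T x) = inner A (S y) x := fun x y => by
    rw [← star_inner, h, star_inner]
  let L : E →ₗ[ℂ] E :=
    { toFun := T
      map_add' := fun x y => ext_inner_left A fun z => by
        rw [h', inner_add_right, inner_add_right, h', h']
      map_smul' := fun c x => ext_inner_left A fun z => by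
        rw [h', RingHom.id_apply, inner_smul_right, inner_smul_right, h'] }
  have hL : Continuous L := by
    refine LinearMap.continuous_of_seq_closed_graph L fun u x y hu hTu => ?_
    refine ext_inner_left A fun z => ?_
    refine tendsto_nhds_unique (((continuous_inner_right (A := A) z).tendsto y).comp hTu) ?_
    have h1 := ((continuous_inner_right (A := A) (S z)).tendsto x).comp hu
    have h2 : inner A z (L x) = inner A (S z) x := h' x z
    rw [h2]
    exact h1.congr fun n => (h' (u n) z).symm
  exact ⟨⟨⟨L, hL⟩, S, h⟩, fun _ => rfl⟩

/-- Every adjointable operator has an adjoint which is again a bounded adjointable operator. -/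
theorem exists_adjoint (T : adjointable A E) :
    ∃ S : adjointable A E, ∀ x y : E,
      inner A ((T : E →L[ℂ] E) x) y = inner A x ((S : E →L[ℂ] E) y) := by
  obtain ⟨T, S, h⟩ := T
  have h' : ∀ x y : E, inner A (S y) x = inner A y (T x) := fun x y => by
    rw [← star_inner, ← h, star_inner]
  let L : E →ₗ[ℂ] E :=
    { toFun := S
      map_add' := fun x y => ext_inner_left A fun z => by
        rw [← h, inner_add_right, inner_add_right, h, h]
      map_smul' := fun c x => ext_inner_left A fun z => by
        rw [← h, RingHom.id_apply, inner_smul_right, inner_smul_right, h] }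
  have hL : ∀ y, ‖L y‖ ≤ ‖T‖ * ‖y‖ := fun y => by
    change ‖S y‖ ≤ ‖T‖ * ‖y‖
    rcases eq_or_ne (S y) 0 with h0 | h0
    · rw [h0, norm_zero]; positivity
    · refine le_of_mul_le_mul_left ?_ (norm_pos_iff.2 h0)
      calc ‖S y‖ * ‖S y‖ = ‖inner A (T (S y)) y‖ := by rw [h, ← norm_sq_eq A, sq]
        _ ≤ ‖T (S y)‖ * ‖y‖ := norm_inner_le _ _
        _ ≤ ‖T‖ * ‖S y‖ * ‖y‖ := by gcongr; exact T.le_opNorm _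
        _ = ‖S y‖ * (‖T‖ * ‖y‖) := by ring
  exact ⟨⟨L.mkContinuous ‖T‖ hL, T, fun x y => h' y x⟩, h⟩

/-- The involution of `L(E)` is the adjoint. -/
noncomputable instance : Star (adjointable A E) where
  star T := (exists_adjoint T).choose

theorem inner_star_right (T : adjointable A E) (x y : E) :
    inner A x (((star T : adjointable A E) : E →L[ℂ] E) y) =
      inner A ((T : E →L[ℂ] E) x) y :=
  ((exists_adjoint T).choose_spec x y).symm

theorem adjointable_ext {S T : adjointable A E}
    (h : ∀ x y : E, inner A x ((S : E →L[ℂ] E) y) = inner A x ((T : E →L[ℂ] E) y)) : S = T :=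
  Subtype.ext <| ContinuousLinearMap.ext fun y => ext_inner_left A fun x => h x y

theorem inner_star_left (T : adjointable A E) (x y : E) :
    inner A (((star T : adjointable A E) : E →L[ℂ] E) x) y =
      inner A x ((T : E →L[ℂ] E) y) := by
  rw [← star_inner, inner_star_right, star_inner]

noncomputable instance : StarRing (adjointable A E) where
  star_involutive T := adjointable_ext fun x y => by rw [inner_star_right, inner_star_left]
  star_mul S T := adjointable_ext fun x y => by
    simp [inner_star_right]
  star_add S T := adjointable_ext fun x y => by
    simp [inner_star_right, inner_add_left, inner_add_right]

instance : StarModule ℂ (adjointable A E) where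
  star_smul c T := adjointable_ext fun x y => by
    simp [inner_star_right, inner_smul_left, inner_smul_right]

theorem norm_mul_self_le_adjointable (T : adjointable A E) : ‖T‖ * ‖T‖ ≤ ‖star T * T‖ := by
  have h : ‖(T : E →L[ℂ] E)‖ ≤ Real.sqrt ‖star T * T‖ := by
    refine ContinuousLinearMap.opNorm_le_bound _ (Real.sqrt_nonneg _) fun x => ?_
    refine (pow_le_pow_iff_left₀ (norm_nonneg _) (by positivity) two_ne_zero).1 ?_
    rw [mul_pow, Real.sq_sqrt (norm_nonneg (star T * T)), norm_sq_eq A, ← inner_star_right]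
    refine (norm_inner_le _ _).trans ?_
    have := ((star T * T : adjointable A E) : E →L[ℂ] E).le_opNorm x
    calc _ ≤ ‖x‖ * (‖star T * T‖ * ‖x‖) := by gcongr; exact this
      _ = _ := by ring
  calc ‖T‖ * ‖T‖ ≤ Real.sqrt ‖star T * T‖ * Real.sqrt ‖star T * T‖ := by gcongr <;> exact h
    _ = _ := Real.mul_self_sqrt (norm_nonneg _)

instance : CStarRing (adjointable A E) where
  norm_mul_self_le := norm_mul_self_le_adjointable

instance [CompleteSpace E] : CompleteSpace (adjointable A E) := by
  refine Metric.complete_of_cauchySeq_tendsto fun u hu => ?_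
  let _ : NonUnitalNormedRing (adjointable A E) := inferInstance
  have : NormedStarGroup (adjointable A E) := CStarRing.to_normedStarGroup
  have hiso : Isometry (star : adjointable A E → adjointable A E) := star_isometry
  have hv : CauchySeq fun n => ((star (u n) : adjointable A E) : E →L[ℂ] E) :=
    (hiso.uniformContinuous.comp_cauchySeq hu).map uniformContinuous_subtype_val
  have hu' : CauchySeq fun n => (u n : E →L[ℂ] E) := hu.map uniformContinuous_subtype_val
  obtain ⟨T, hT⟩ := cauchySeq_tendsto_of_complete hu'
  obtain ⟨S, hS⟩ := cauchySeq_tendsto_of_complete hv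
  have h : ∀ x y : E, inner A (T x) y = inner A x (S y) := fun x y => by
    have h1 := ((continuous_inner_left (A := A) y).tendsto _).comp
      (((ContinuousLinearMap.apply ℂ E x).continuous.tendsto T).comp hT)
    have h2 := ((continuous_inner_right (A := A) x).tendsto _).comp
      (((ContinuousLinearMap.apply ℂ E y).continuous.tendsto S).comp hS)
    exact tendsto_nhds_unique h1 (h2.congr fun n => inner_star_right (u n) x y)
  exact ⟨⟨T, S, h⟩, tendsto_subtype_rng.2 hT⟩

/-- The adjointable operators on a Hilbert C⋆-module form a unital C⋆-algebra. -/
noncomputable instance [CompleteSpace E] : CStarAlgebra (adjointable A E) where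

end RightPreHilbertModule

/-!
Localize the module at a positive functional `φ` of `A`: the completion of `E` for the semi-inner
product `φ ⟨y, z⟩` is a Hilbert space on which `T` acts, and `a ↦ x a` induces a contraction `V`
into it from the GNS space of `φ`. Since `⟨x a, T (x b)⟩ = a⋆ ⟨x, T x⟩ b`, the GNS representation
sends `⟨x, T x⟩` to `V† T V`, so Jensen's inequality for contractions of Hilbert spaces gives the
claim after applying `φ`, and positive functionals determine the order of `A`.

A contraction `V` is the second entry of the isometry `W = (√(1 - V† V), V)`, and
`W† (0 ⊕ T) W = V† T V`; the condition `f 0 ≤ 0` disposes of the first entry, which reduces the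
inequality to isometries. For an isometry `W` with reflection `R = 2 W W† - 1`, midpoint convexity
applied to `X` and `R X R` suffices: `Y = (X + R X R) / 2` satisfies `Y W = W (W† X W)`, and this
intertwining relation passes to `f`.
-/

section

open scoped ComplexOrder CStarAlgebra InnerProductSpace

open ContinuousLinearMap MulOpposite UniformSpace

section PositiveLinearMap

variable {B C : Type*} [CStarAlgebra B] [PartialOrder B] [StarOrderedRing B]
  [CStarAlgebra C] [PartialOrder C] [StarOrderedRing C]

theorem spectrum_subset_Icc_iff {b : B} (hb : IsSelfAdjoint b) {m M : ℝ} :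
    spectrum ℝ b ⊆ Set.Icc m M ↔ algebraMap ℝ B m ≤ b ∧ b ≤ algebraMap ℝ B M := by
  rw [algebraMap_le_iff_le_spectrum, le_algebraMap_iff_spectrum_le, ← forall₂_and]
  rfl

theorem spectrum_map_subset_Icc (Φ : B →ₚ[ℂ] C) {b : B} (hb : IsSelfAdjoint b) {m M : ℝ}
    (hm : m • 1 ≤ m • Φ 1) (hM : M • Φ 1 ≤ M • 1) (h : spectrum ℝ b ⊆ Set.Icc m M) :
    spectrum ℝ (Φ b) ⊆ Set.Icc m M := by
  have map_smul_one (r : ℝ) : Φ (r • 1) = r • Φ 1 := Φ.toLinearMap.map_smul_of_tower r 1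
  rw [spectrum_subset_Icc_iff hb, Algebra.algebraMap_eq_smul_one,
    Algebra.algebraMap_eq_smul_one] at h
  rw [spectrum_subset_Icc_iff (hb.map' Φ), Algebra.algebraMap_eq_smul_one,
    Algebra.algebraMap_eq_smul_one]
  constructor
  · calc m • 1 ≤ Φ (m • 1) := by rwa [map_smul_one]
      _ ≤ Φ b := OrderHomClass.mono Φ h.1
  · calc Φ b ≤ Φ (M • 1) := OrderHomClass.mono Φ h.2
      _ ≤ M • 1 := by rwa [map_smul_one]

theorem spectrum_map_subset_of_map_one (Φ : B →ₚ[ℂ] C) (hΦ : Φ 1 = 1) {J : Set ℝ}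
    (hJ : J.OrdConnected) {b : B} (hb : IsSelfAdjoint b) (hbJ : spectrum ℝ b ⊆ J) :
    spectrum ℝ (Φ b) ⊆ J := by
  nontriviality C
  have : Nontrivial B := ⟨1, 0, fun h => one_ne_zero (hΦ.symm.trans (by rw [h, map_zero]))⟩
  have hne : (spectrum ℝ b).Nonempty := ContinuousFunctionalCalculus.spectrum_nonempty b hb
  obtain ⟨m, hm⟩ := (spectrum.isCompact b).exists_isLeast hne
  obtain ⟨M, hM⟩ := (spectrum.isCompact b).exists_isGreatest hne
  have hIcc : spectrum ℝ (Φ b) ⊆ Set.Icc m M :=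
    spectrum_map_subset_Icc Φ hb (by rw [hΦ]) (by rw [hΦ]) fun r hr => ⟨hm.2 hr, hM.2 hr⟩
  exact hIcc.trans (hJ.out (hbJ hm.1) (hbJ hM.1))

theorem spectrum_map_subset_of_map_one_le (Φ : B →ₚ[ℂ] C) (hΦ : Φ 1 ≤ 1) {J : Set ℝ}
    (hJ : J.OrdConnected) (h0 : 0 ∈ J) {b : B} (hb : IsSelfAdjoint b) (hbJ : spectrum ℝ b ⊆ J) :
    spectrum ℝ (Φ b) ⊆ J := by
  have hK : IsCompact (insert 0 (spectrum ℝ b)) := (spectrum.isCompact b).insert 0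
  obtain ⟨m, hm⟩ := hK.exists_isLeast (Set.insert_nonempty ..)
  obtain ⟨M, hM⟩ := hK.exists_isGreatest (Set.insert_nonempty ..)
  have hIcc : spectrum ℝ (Φ b) ⊆ Set.Icc m M :=
    spectrum_map_subset_Icc Φ hb
      (smul_le_smul_of_nonpos_left hΦ (hm.2 (Set.mem_insert ..)))
      (smul_le_smul_of_nonneg_left hΦ (hM.2 (Set.mem_insert ..)))
      fun r hr => ⟨hm.2 (Set.mem_insert_of_mem _ hr), hM.2 (Set.mem_insert_of_mem _ hr)⟩
  exact hIcc.trans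
    (hJ.out (Set.insert_subset h0 hbJ hm.1) (Set.insert_subset h0 hbJ hM.1))

theorem exists_positiveLinearMap_neg {b : B} (hb : IsSelfAdjoint b) (h : ¬ 0 ≤ b) :
    ∃ φ : B →ₚ[ℂ] ℂ, φ b < 0 := by
  let nonnegCone : ProperCone ℝ B :=
    ⟨PointedCone.positive ℝ B, CStarAlgebra.isClosed_nonneg⟩
  obtain ⟨l, hl, hlb⟩ := ProperCone.hyperplane_separation_point nonnegCone h
  let ψ : B →ₗ[ℂ] ℂ := Module.Dual.extendRCLike
    (l.toLinearMap ∘ₗ (selfAdjoint.submodule ℝ B).subtype ∘ₗ realPart)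
  have hψ {a : B} (ha : IsSelfAdjoint a) : ψ a = l a := by
    calc ψ a = l (realPart a : B) - Complex.I * l (realPart (Complex.I • a) : B) := rfl
      _ = l a := by simp [realPart_I_smul, ha.imaginaryPart, ha.coe_realPart]
  refine ⟨.mk₀ ψ fun a ha => ?_, ?_⟩
  · change 0 ≤ ψ a
    rw [hψ (.of_nonneg ha)]
    exact_mod_cast hl a ha
  · change ψ b < 0
    rw [hψ hb]
    exact_mod_cast hlb

theorem le_of_forall_positiveLinearMap_le {a b : B} (ha : IsSelfAdjoint a) (hb : IsSelfAdjoint b)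
    (h : ∀ φ : B →ₚ[ℂ] ℂ, φ a ≤ φ b) : a ≤ b := by
  by_contra hab
  obtain ⟨φ, hφ⟩ := exists_positiveLinearMap_neg (hb.sub ha) (mt sub_nonneg.1 hab)
  rw [map_sub, sub_neg] at hφ
  exact hφ.not_ge (h φ)

omit [StarOrderedRing B] in
theorem map_le_mul_map_of_le_smul (φ : B →ₚ[ℂ] ℂ) {a b : B} {r : ℝ} (h : a ≤ r • b) :
    φ a ≤ r * φ b :=
  calc φ a ≤ φ (r • b) := OrderHomClass.mono φ h
    _ = r * φ b := by rw [← Complex.coe_smul, map_smul, smul_eq_mul]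

theorem map_le_map_of_gnsStarAlgHom_le {φ : B →ₚ[ℂ] ℂ} {a b : B}
    (h : φ.gnsStarAlgHom a ≤ φ.gnsStarAlgHom b) : φ a ≤ φ b := by
  have inner_one (c : B) :
      ⟪(φ.toPreGNS 1 : φ.GNS), φ.gnsStarAlgHom c (φ.toPreGNS 1 : φ.GNS)⟫_ℂ = φ c := by
    simp [φ.preGNS_inner_def]
  have h1 := ((le_def _ _).1 h).inner_nonneg_right (φ.toPreGNS 1 : φ.GNS)
  rwa [sub_apply, inner_sub_right, inner_one, inner_one, sub_nonneg] at h1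

theorem spectrum_convexCombination_subset {J : Set ℝ} (hJ : J.OrdConnected) {a b : B}
    (ha : IsSelfAdjoint a) (hb : IsSelfAdjoint b) (haJ : spectrum ℝ a ⊆ J)
    (hbJ : spectrum ℝ b ⊆ J) {t : ℝ} (ht₀ : 0 ≤ t) (ht₁ : t ≤ 1) :
    spectrum ℝ ((1 - t) • a + t • b) ⊆ J := by
  let Φ : B × B →ₚ[ℂ] B := .mk₀
    (((1 - t : ℝ) : ℂ) • LinearMap.fst ℂ B B + (t : ℂ) • LinearMap.snd ℂ B B) fun p hp =>
      add_nonneg (smul_nonneg (by exact_mod_cast sub_nonneg.2 ht₁) hp.1)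
        (smul_nonneg (by exact_mod_cast ht₀) hp.2)
  have hΦ (p : B × B) : Φ p = (1 - t) • p.1 + t • p.2 := by
    simp only [← Complex.coe_smul]
    rfl
  rw [← hΦ (a, b)]
  refine spectrum_map_subset_of_map_one Φ ?_ hJ (Prod.ext ha hb) ?_
  · rw [hΦ, Prod.fst_one, Prod.snd_one, ← add_smul, sub_add_cancel, one_smul]
  · exact (Prod.spectrum_eq a b).subset.trans (Set.union_subset haJ hbJ)

end PositiveLinearMap

section CFC

variable {B C D : Type*} [CStarAlgebra B] [CStarAlgebra C] [CStarAlgebra D]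

theorem cfc_map_prodMk (φ : B × C →⋆ₐ[ℂ] D) {b : B} {c : C} (hb : IsSelfAdjoint b)
    (hc : IsSelfAdjoint c) {f : ℝ → ℝ} (hf : ContinuousOn f (spectrum ℝ b ∪ spectrum ℝ c)) :
    cfc f (φ (b, c)) = φ (cfc f b, cfc f c) := by
  have hbc : IsSelfAdjoint (b, c) := Prod.ext hb hc
  have hφ : Continuous φ := map_continuous φ
  have : ContinuousFunctionalCalculus ℝ (B × C) IsSelfAdjoint :=
    IsSelfAdjoint.instContinuousFunctionalCalculus
  rw [← cfc_map_prod (S := ℂ) f b c hf hbc hb hc]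
  exact (StarAlgHomClass.map_cfc φ f (b, c) (by rwa [Prod.spectrum_eq]) hφ hbc
    (hbc.map φ)).symm

theorem cfc_unitary_conj (U : unitary B) {b : B} (hb : IsSelfAdjoint b) {f : ℝ → ℝ}
    (hf : ContinuousOn f (spectrum ℝ b)) :
    cfc f (U * b * star (U : B)) = U * cfc f b * star (U : B) := by
  let φ : B →⋆ₐ[ℂ] B := Unitary.conjStarAlgAut ℂ B U
  exact (StarAlgHomClass.map_cfc φ f b hf (map_continuous φ) hb (hb.map φ)).symm

end CFC

/-! ### Jensen's inequality for operators on Hilbert spaces -/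

section Operator

variable {H H₁ H₂ K : Type*}
  [NormedAddCommGroup H] [InnerProductSpace ℂ H] [CompleteSpace H]
  [NormedAddCommGroup H₁] [InnerProductSpace ℂ H₁] [CompleteSpace H₁]
  [NormedAddCommGroup H₂] [InnerProductSpace ℂ H₂] [CompleteSpace H₂]
  [NormedAddCommGroup K] [InnerProductSpace ℂ K] [CompleteSpace K]

/-- The compression `X ↦ W† X W` along an operator `W : K → H`, as a positive linear map. -/
noncomputable def compression (W : K →L[ℂ] H) : (H →L[ℂ] H) →ₚ[ℂ] (K →L[ℂ] K) :=
  .mk₀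
    { toFun := fun X => adjoint W ∘L X ∘L W
      map_add' := fun X Y => by simp
      map_smul' := fun c X => by simp }
    fun X hX => (nonneg_iff_isPositive _).2 (((nonneg_iff_isPositive X).1 hX).adjoint_conj W)

theorem compression_apply (W : K →L[ℂ] H) (X : H →L[ℂ] H) :
    compression W X = adjoint W ∘L X ∘L W := rfl

theorem compression_one {W : K →L[ℂ] H} (hW : adjoint W ∘L W = 1) : compression W 1 = 1 := hW

/-- The diagonal operator `h₁ ⊕ h₂ ↦ A h₁ ⊕ B h₂` on the Hilbert sum, as a ⋆-homomorphism in
`(A, B)`. -/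
noncomputable def blockDiag :
    (H₁ →L[ℂ] H₁) × (H₂ →L[ℂ] H₂) →⋆ₐ[ℂ] (WithLp 2 (H₁ × H₂) →L[ℂ] WithLp 2 (H₁ × H₂)) where
  toFun A := (WithLp.prodContinuousLinearEquiv 2 ℂ H₁ H₂).symm.toContinuousLinearMap ∘L
    A.1.prodMap A.2 ∘L (WithLp.prodContinuousLinearEquiv 2 ℂ H₁ H₂).toContinuousLinearMap
  map_one' := rfl
  map_mul' _ _ := rfl
  map_zero' := rfl
  map_add' _ _ := rfl
  commutes' _ := rfl
  map_star' A := by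
    rw [star_eq_adjoint, eq_adjoint_iff]
    intro x y
    simp [WithLp.prod_inner_apply, star_eq_adjoint, adjoint_inner_left]

/-- The operator `k ↦ D k ⊕ V k` into the Hilbert sum. -/
noncomputable def column (D : K →L[ℂ] H₁) (V : K →L[ℂ] H₂) : K →L[ℂ] WithLp 2 (H₁ × H₂) :=
  (WithLp.prodContinuousLinearEquiv 2 ℂ H₁ H₂).symm.toContinuousLinearMap ∘L D.prod V

theorem blockDiag_apply (A : H₁ →L[ℂ] H₁) (B : H₂ →L[ℂ] H₂) (x : WithLp 2 (H₁ × H₂)) :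
    blockDiag (A, B) x = WithLp.toLp 2 (A x.fst, B x.snd) := rfl

theorem compression_column_blockDiag (D : K →L[ℂ] H₁) (V : K →L[ℂ] H₂)
    (A : H₁ →L[ℂ] H₁) (B : H₂ →L[ℂ] H₂) :
    compression (column D V) (blockDiag (A, B)) = compression D A + compression V B := by
  refine ContinuousLinearMap.ext fun x => ext_inner_left ℂ fun y => ?_
  simp [adjoint_inner_right, inner_add_right, column, blockDiag_apply, WithLp.prod_inner_apply,
    compression_apply]

theorem isSelfAdjoint_blockDiag {A : H₁ →L[ℂ] H₁} {B : H₂ →L[ℂ] H₂} (hA : IsSelfAdjoint A)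
    (hB : IsSelfAdjoint B) : IsSelfAdjoint (blockDiag (A, B)) :=
  IsSelfAdjoint.map (x := (A, B)) (Prod.ext hA hB) blockDiag

theorem spectrum_blockDiag_subset (A : H₁ →L[ℂ] H₁) (B : H₂ →L[ℂ] H₂) :
    spectrum ℝ (blockDiag (A, B)) ⊆ spectrum ℝ A ∪ spectrum ℝ B := by
  rw [← Prod.spectrum_eq]
  exact AlgHom.spectrum_apply_subset (blockDiag.restrictScalars ℝ) (A, B)

theorem cfc_blockDiag {A : H₁ →L[ℂ] H₁} {B : H₂ →L[ℂ] H₂} (hA : IsSelfAdjoint A)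
    (hB : IsSelfAdjoint B) {f : ℝ → ℝ} (hf : ContinuousOn f (spectrum ℝ A ∪ spectrum ℝ B)) :
    cfc f (blockDiag (A, B)) = blockDiag (cfc f A, cfc f B) :=
  cfc_map_prodMk (blockDiag (H₁ := H₁) (H₂ := H₂)) hA hB hf

theorem cfc_comp_eq_comp_cfc {Y : H₂ →L[ℂ] H₂} {Z : H₁ →L[ℂ] H₁} (hY : IsSelfAdjoint Y)
    (hZ : IsSelfAdjoint Z) {W : H₁ →L[ℂ] H₂} (hW : Y ∘L W = W ∘L Z) {f : ℝ → ℝ}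
    (hf : ContinuousOn f (spectrum ℝ Z ∪ spectrum ℝ Y)) :
    cfc f Y ∘L W = W ∘L cfc f Z := by
  -- An intertwining relation is the commutation of `Z ⊕ Y` with the corner operator `S` of `W`.
  let S : WithLp 2 (H₁ × H₂) →L[ℂ] WithLp 2 (H₁ × H₂) := column 0 W ∘L WithLp.fstL 2 ℂ H₁ H₂
  have commute_iff (A : H₁ →L[ℂ] H₁) (B : H₂ →L[ℂ] H₂) :
      Commute (blockDiag (A, B)) S ↔ B ∘L W = W ∘L A := by
    constructor
    · intro h
      ext k
      have hk := congr(WithLp.snd ($h.eq (WithLp.toLp 2 (k, 0))))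
      simpa [S, column, blockDiag_apply] using hk
    · intro h
      ext x
      simpa [S, column, blockDiag_apply] using congr($h x.fst)
  rw [← commute_iff] at hW ⊢
  rw [← cfc_blockDiag hZ hY hf]
  exact hW.cfc_real f

theorem isStarProjection_comp_adjoint {W : K →L[ℂ] H} (hW : adjoint W ∘L W = 1) :
    IsStarProjection (W ∘L adjoint W) where
  isIdempotentElem := by
    change (W ∘L adjoint W) ∘L (W ∘L adjoint W) = W ∘L adjoint W
    rw [comp_assoc, ← comp_assoc _ W, hW, one_def, id_comp]
  isSelfAdjoint := by
    rw [isSelfAdjoint_iff', adjoint_comp, adjoint_adjoint]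

/-- The reflection `2 W W† - 1` in the range of an isometry `W`. -/
noncomputable def rangeReflection {W : K →L[ℂ] H} (hW : adjoint W ∘L W = 1) :
    unitary (H →L[ℂ] H) :=
  ⟨2 * (W ∘L adjoint W) - 1, (isStarProjection_comp_adjoint hW).two_mul_sub_one_mem_unitary⟩

theorem star_rangeReflection {W : K →L[ℂ] H} (hW : adjoint W ∘L W = 1) :
    star (rangeReflection hW : H →L[ℂ] H) = rangeReflection hW := by
  simp [rangeReflection, (isStarProjection_comp_adjoint hW).isSelfAdjoint.star_eq, two_mul]

theorem rangeReflection_comp {W : K →L[ℂ] H} (hW : adjoint W ∘L W = 1) :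
    (rangeReflection hW : H →L[ℂ] H) ∘L W = W := by
  change (2 * (W ∘L adjoint W) - 1) ∘L W = W
  rw [two_mul, sub_comp, add_comp, comp_assoc, hW]
  simp [one_def]

/-- The pinching `X ↦ (X + R X R†) / 2`, with `R` the reflection in the range of an isometry `W`. -/
noncomputable def pinching {W : K →L[ℂ] H} (hW : adjoint W ∘L W = 1) (X : H →L[ℂ] H) :
    H →L[ℂ] H :=
  (1 - 2⁻¹ : ℝ) • X + (2⁻¹ : ℝ) • (rangeReflection hW * X * star (rangeReflection hW : H →L[ℂ] H))

theorem pinching_comp {W : K →L[ℂ] H} (hW : adjoint W ∘L W = 1) (X : H →L[ℂ] H) :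
    pinching hW X ∘L W = W ∘L compression W X := by
  have hconj : (rangeReflection hW * X * star (rangeReflection hW : H →L[ℂ] H) : H →L[ℂ] H) ∘L W =
      2 • (W ∘L compression W X) - X ∘L W := by
    rw [star_rangeReflection]
    change ((rangeReflection hW : H →L[ℂ] H) ∘L X ∘L rangeReflection hW) ∘L W = _
    rw [comp_assoc, comp_assoc, rangeReflection_comp]
    change (2 * (W ∘L adjoint W) - 1) ∘L X ∘L W = _
    rw [two_mul, sub_comp, add_comp, two_nsmul]
    rfl
  rw [pinching, add_comp, smul_comp, smul_comp, hconj]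
  module

theorem isSelfAdjoint_pinching {W : K →L[ℂ] H} (hW : adjoint W ∘L W = 1) {X : H →L[ℂ] H}
    (hX : IsSelfAdjoint X) : IsSelfAdjoint (pinching hW X) := by
  have hRX := hX.conjugate (rangeReflection hW : H →L[ℂ] H)
  exact IsSelfAdjoint.add (.smul (.all _) hX) (.smul (.all _) hRX)

theorem spectrum_pinching_subset {W : K →L[ℂ] H} (hW : adjoint W ∘L W = 1) {J : Set ℝ}
    (hJ : J.OrdConnected) {X : H →L[ℂ] H} (hX : IsSelfAdjoint X) (hXJ : spectrum ℝ X ⊆ J) :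
    spectrum ℝ (pinching hW X) ⊆ J := by
  refine spectrum_convexCombination_subset hJ hX (hX.conjugate _) hXJ ?_ (by norm_num)
    (by norm_num)
  rwa [Unitary.spectrum_star_right_conjugate]

theorem compression_eq_of_comp_eq_comp {W : K →L[ℂ] H} (hW : adjoint W ∘L W = 1)
    {Y : H →L[ℂ] H} {Z : K →L[ℂ] K} (h : Y ∘L W = W ∘L Z) : compression W Y = Z := by
  rw [compression_apply, h, ← comp_assoc, hW, one_def, id_comp]

theorem compression_one_le {V : K →L[ℂ] H} (hV : ‖V‖ ≤ 1) : compression V 1 ≤ 1 := by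
  rw [← CStarAlgebra.norm_le_one_iff_of_nonneg _ (map_nonneg _ zero_le_one)]
  calc ‖compression V 1‖ = ‖V‖ * ‖V‖ := norm_adjoint_comp_self V
    _ ≤ 1 := mul_le_one₀ hV (norm_nonneg V) hV

/-- The defect operator `(1 - V† V) ^ (1/2)` of a contraction `V`. -/
noncomputable def defect (V : K →L[ℂ] H) : K →L[ℂ] K := CFC.sqrt (1 - compression V 1)

theorem compression_defect_one {V : K →L[ℂ] H} (hV : ‖V‖ ≤ 1) :
    compression (defect V) 1 = 1 - compression V 1 := by
  have hnonneg : 0 ≤ 1 - compression V 1 := sub_nonneg.2 (compression_one_le hV)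
  have hsa : IsSelfAdjoint (defect V) := .of_nonneg (CFC.sqrt_nonneg _)
  calc compression (defect V) 1 = star (defect V) * defect V := rfl
    _ = 1 - compression V 1 := by rw [hsa.star_eq, defect, CFC.sqrt_mul_sqrt_self _ hnonneg]

theorem adjoint_comp_column_defect {V : K →L[ℂ] H} (hV : ‖V‖ ≤ 1) :
    adjoint (column (defect V) V) ∘L column (defect V) V = 1 := by
  calc adjoint (column (defect V) V) ∘L column (defect V) V
      = compression (column (defect V) V) (blockDiag (1, 1)) := by
        rw [← Prod.one_eq_mk, map_one]; rfl
    _ = 1 := by rw [compression_column_blockDiag, compression_defect_one hV, sub_add_cancel]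

end Operator

namespace OperatorConvexOn

variable {J : Set ℝ} {f : ℝ → ℝ}

section Isometry

universe w

variable {H : Type w} {K : Type*} [NormedAddCommGroup H] [InnerProductSpace ℂ H] [CompleteSpace H]
  [NormedAddCommGroup K] [InnerProductSpace ℂ K] [CompleteSpace K]
  {W : K →L[ℂ] H} {X : H →L[ℂ] H}

theorem cfc_pinching_le (hf : OperatorConvexOn.{w} J f) (hW : adjoint W ∘L W = 1)
    (hX : IsSelfAdjoint X) (hXJ : spectrum ℝ X ⊆ J) :
    cfc f (pinching hW X) ≤ pinching hW (cfc f X) := by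
  rw [pinching, pinching, ← cfc_unitary_conj _ hX (hf.1.mono hXJ)]
  refine hf.2 H X _ 2⁻¹ hX (hX.conjugate _) hXJ ?_ (by norm_num) (by norm_num)
  rwa [Unitary.spectrum_star_right_conjugate]

theorem cfc_compression_le (hJ : J.OrdConnected) (hf : OperatorConvexOn.{w} J f)
    (hW : adjoint W ∘L W = 1) (hX : IsSelfAdjoint X) (hXJ : spectrum ℝ X ⊆ J) :
    cfc f (compression W X) ≤ compression W (cfc f X) := by
  have hcont : ContinuousOn f (spectrum ℝ (compression W X) ∪ spectrum ℝ (pinching hW X)) :=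
    hf.1.mono <| Set.union_subset
      (spectrum_map_subset_of_map_one (compression W) (compression_one hW) hJ hX hXJ)
      (spectrum_pinching_subset hW hJ hX hXJ)
  have hintertwine : cfc f (pinching hW X) ∘L W = W ∘L cfc f (compression W X) :=
    cfc_comp_eq_comp_cfc (isSelfAdjoint_pinching hW hX) (hX.map' (compression W))
      (pinching_comp hW X) hcont
  calc cfc f (compression W X) = compression W (cfc f (pinching hW X)) :=
        (compression_eq_of_comp_eq_comp hW hintertwine).symm
    _ ≤ compression W (pinching hW (cfc f X)) := OrderHomClass.mono _ (hf.cfc_pinching_le hW hX hXJ)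
    _ = compression W (cfc f X) := compression_eq_of_comp_eq_comp hW (pinching_comp hW _)

end Isometry

theorem cfc_compression_le_of_norm_le_one {K : Type u} {H : Type v} [NormedAddCommGroup K]
    [InnerProductSpace ℂ K] [CompleteSpace K] [NormedAddCommGroup H] [InnerProductSpace ℂ H]
    [CompleteSpace H] (hJ : J.OrdConnected) (h0 : 0 ∈ J)
    (hf : OperatorConvexOn.{max u v} J f) (hf0 : f 0 ≤ 0) {V : K →L[ℂ] H} (hV : ‖V‖ ≤ 1)
    {T : H →L[ℂ] H} (hT : IsSelfAdjoint T) (hTJ : spectrum ℝ T ⊆ J) :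
    cfc f (compression V T) ≤ compression V (cfc f T) := by
  have hunion : spectrum ℝ (0 : K →L[ℂ] K) ∪ spectrum ℝ T ⊆ J := by
    refine Set.union_subset ?_ hTJ
    nontriviality K →L[ℂ] K
    rwa [spectrum.zero_eq, Set.singleton_subset_iff]
  have hle := hf.cfc_compression_le hJ (adjoint_comp_column_defect hV)
    (isSelfAdjoint_blockDiag (.zero _) hT) ((spectrum_blockDiag_subset 0 T).trans hunion)
  rw [cfc_blockDiag (.zero _) hT (hf.1.mono hunion), compression_column_blockDiag,
    compression_column_blockDiag, map_zero, zero_add] at hle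
  have hdefect : compression (defect V) (cfc f 0) ≤ 0 := by
    have hcfc : cfc f (0 : K →L[ℂ] K) ≤ 0 := by
      rw [cfc_apply_zero, Algebra.algebraMap_eq_smul_one]
      exact smul_nonpos_of_nonpos_of_nonneg hf0 zero_le_one
    exact (OrderHomClass.mono _ hcfc).trans_eq (map_zero _)
  exact hle.trans (add_le_of_nonpos_left hdefect)

end OperatorConvexOn

/-! ### Localization at a positive functional -/

theorem completion_clm_ext {𝕜 X F : Type*} [NontriviallyNormedField 𝕜] [SeminormedAddCommGroup X]
    [NormedSpace 𝕜 X] [NormedAddCommGroup F] [NormedSpace 𝕜 F] {S T : Completion X →L[𝕜] F}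
    (h : ∀ x : X, S x = T x) : S = T :=
  DFunLike.coe_injective (Completion.ext S.continuous T.continuous h)

namespace RightPreHilbertModule

section Adjointable

variable {A E : Type*} [CStarAlgebra A] [PartialOrder A] [StarOrderedRing A]
  [NormedAddCommGroup E] [NormedSpace ℂ E] [Module Aᵐᵒᵖ E] [RightPreHilbertModule A E]

theorem adjointable_apply_op_smul (T : adjointable A E) (x : E) (a : A) :
    (T : E →L[ℂ] E) (op a • x) = op a • (T : E →L[ℂ] E) x :=
  ext_inner_left A fun y => by
    rw [← inner_star_left, inner_op_smul_right, inner_star_left, inner_op_smul_right]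

theorem inner_self_le_one {x : E} (hx : ‖x‖ ≤ 1) : inner A x x ≤ 1 := by
  rw [← CStarAlgebra.norm_le_one_iff_of_nonneg _ (inner_self_nonneg x), ← norm_sq_eq]
  exact pow_le_one₀ (norm_nonneg x) hx

theorem inner_op_smul_self_le (x : E) (a : A) :
    inner A (op a • x) (op a • x) ≤ ‖x‖ ^ 2 • (star a * a) := by
  rw [inner_op_smul_left, inner_op_smul_right, ← mul_assoc, norm_sq_eq A]
  exact CStarAlgebra.star_left_conjugate_le_norm_smul
    (hb := .of_nonneg (inner_self_nonneg x))

variable [CompleteSpace E]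

noncomputable instance : PartialOrder (adjointable A E) := CStarAlgebra.spectralOrder _

instance : StarOrderedRing (adjointable A E) := CStarAlgebra.spectralOrderedRing _

/-- The positive linear map `T ↦ ⟨x, T x⟩` from `L(E)` to `A`. -/
noncomputable def vectorMap (x : E) : adjointable A E →ₚ[ℂ] A :=
  .mk₀
    { toFun := fun T => inner A x ((T : E →L[ℂ] E) x)
      map_add' := fun S T => inner_add_right x _ _
      map_smul' := fun c T => inner_smul_right x _ c }
    fun T hT => by
      obtain ⟨S, rfl⟩ := CStarAlgebra.nonneg_iff_eq_star_mul_self.1 hT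
      change 0 ≤ inner A x (((star S : adjointable A E) : E →L[ℂ] E) ((S : E →L[ℂ] E) x))
      rw [inner_star_right]
      exact inner_self_nonneg _

theorem vectorMap_apply (x : E) (T : adjointable A E) :
    vectorMap x T = inner A x ((T : E →L[ℂ] E) x) := rfl

theorem vectorMap_one (x : E) : vectorMap x (1 : adjointable A E) = inner A x x := rfl

theorem inner_apply_self_le (T : adjointable A E) (x : E) :
    inner A ((T : E →L[ℂ] E) x) ((T : E →L[ℂ] E) x) ≤ ‖T‖ ^ 2 • inner A x x := by
  calc inner A ((T : E →L[ℂ] E) x) ((T : E →L[ℂ] E) x)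
      = vectorMap x (star T * T) := (inner_star_right T x _).symm
    _ ≤ vectorMap x (algebraMap ℝ _ (‖T‖ ^ 2)) :=
      OrderHomClass.mono _ CStarAlgebra.star_mul_le_algebraMap_norm_sq
    _ = ‖T‖ ^ 2 • inner A x x := by
      rw [Algebra.algebraMap_eq_smul_one, ← vectorMap_one]
      exact (vectorMap x).toLinearMap.map_smul_of_tower _ _

end Adjointable

/-- The space `E` with the semi-inner product `φ ⟨x, y⟩` induced by a positive functional `φ`. -/
def PreLocalization {A : Type*} [CStarAlgebra A] [PartialOrder A] (_φ : A →ₚ[ℂ] ℂ)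
    (E : Type*) := E

namespace PreLocalization

variable {A : Type*} [CStarAlgebra A] [PartialOrder A] (φ : A →ₚ[ℂ] ℂ)
  {E : Type*} [NormedAddCommGroup E] [NormedSpace ℂ E]

noncomputable instance : AddCommGroup (PreLocalization φ E) := inferInstanceAs (AddCommGroup E)
noncomputable instance : Module ℂ (PreLocalization φ E) := inferInstanceAs (Module ℂ E)

variable (E) in
/-- The identity map from `E` to `PreLocalization φ E`. -/
def mk : E ≃ₗ[ℂ] PreLocalization φ E := LinearEquiv.refl ℂ E

variable [Module Aᵐᵒᵖ E] [RightPreHilbertModule A E] [StarOrderedRing A]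

/-- The semi-inner product of `PreLocalization φ E`. -/
noncomputable abbrev core : PreInnerProductSpace.Core ℂ (PreLocalization φ E) where
  inner x y := φ (inner A ((mk φ E).symm x) ((mk φ E).symm y))
  conj_inner_symm x y := by rw [← Complex.star_def, ← map_star φ, star_inner]
  re_inner_nonneg x := (RCLike.nonneg_iff.1 (φ.map_nonneg (inner_self_nonneg _))).1
  add_left x y z := by rw [map_add, inner_add_left, map_add]
  smul_left x y c := by rw [map_smul, inner_smul_left, map_smul]; rfl

noncomputable instance : SeminormedAddCommGroup (PreLocalization φ E) :=
  InnerProductSpace.Core.toSeminormedAddCommGroup (c := core φ)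

noncomputable instance : InnerProductSpace ℂ (PreLocalization φ E) :=
  InnerProductSpace.ofCore (core φ)

variable {φ}

theorem inner_def (x y : PreLocalization φ E) :
    ⟪x, y⟫_ℂ = φ (inner A ((mk φ E).symm x) ((mk φ E).symm y)) := rfl

theorem norm_sq_eq (x : PreLocalization φ E) :
    (‖x‖ ^ 2 : ℂ) = φ (inner A ((mk φ E).symm x) ((mk φ E).symm x)) :=
  (inner_self_eq_norm_sq_to_K (𝕜 := ℂ) x).symm

variable [CompleteSpace E]

/-- An adjointable operator, acting on `PreLocalization φ E`. -/
noncomputable def map (φ : A →ₚ[ℂ] ℂ) (T : adjointable A E) :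
    PreLocalization φ E →L[ℂ] PreLocalization φ E :=
  ((mk φ E).toLinearMap ∘ₗ (T : E →L[ℂ] E).toLinearMap ∘ₗ
    (mk φ E).symm.toLinearMap).mkContinuous ‖T‖ fun x => by
    rw [← sq_le_sq₀ (norm_nonneg _) (by positivity), mul_pow, ← Complex.real_le_real]
    push_cast
    rw [norm_sq_eq, norm_sq_eq, ← Complex.ofReal_pow]
    exact map_le_mul_map_of_le_smul φ (inner_apply_self_le T _)

theorem map_apply (T : adjointable A E) (x : PreLocalization φ E) :
    map φ T x = mk φ E ((T : E →L[ℂ] E) ((mk φ E).symm x)) := rfl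

end PreLocalization

/-- The localization of a Hilbert module at a positive functional `φ`: the Hilbert space
completion of `PreLocalization φ E`. -/
abbrev Localization {A : Type*} [CStarAlgebra A] [PartialOrder A] [StarOrderedRing A]
    (φ : A →ₚ[ℂ] ℂ) (E : Type*) [NormedAddCommGroup E] [NormedSpace ℂ E] [Module Aᵐᵒᵖ E]
    [RightPreHilbertModule A E] : Type _ :=
  Completion (PreLocalization φ E)

namespace Localization

variable {A E : Type*} [CStarAlgebra A] [PartialOrder A] [StarOrderedRing A] (φ : A →ₚ[ℂ] ℂ)
  [NormedAddCommGroup E] [NormedSpace ℂ E] [Module Aᵐᵒᵖ E] [RightPreHilbertModule A E]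
  [CompleteSpace E]

/-- The representation of `L(E)` on the localization of `E` at `φ`. -/
noncomputable def rep : adjointable A E →⋆ₐ[ℂ] (Localization φ E →L[ℂ] Localization φ E) where
  toFun T := (PreLocalization.map φ T).completion
  map_one' := completion_clm_ext fun x => by simp [PreLocalization.map_apply]
  map_mul' S T := completion_clm_ext fun x => by simp [PreLocalization.map_apply]
  map_zero' := completion_clm_ext fun x => by simp [PreLocalization.map_apply, Completion.coe_zero]
  map_add' S T := completion_clm_ext fun x => by
    simp [PreLocalization.map_apply, Completion.coe_add]
  commutes' c := completion_clm_ext fun x => by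
    simp [PreLocalization.map_apply, Algebra.algebraMap_eq_smul_one, Completion.coe_smul]
  map_star' T := by
    rw [star_eq_adjoint, eq_adjoint_iff]
    intro z w
    induction z, w using Completion.induction_on₂ with
    | hp => apply isClosed_eq <;> fun_prop
    | ih x y => simp [PreLocalization.map_apply, PreLocalization.inner_def, inner_star_left]

theorem rep_apply_coe (T : adjointable A E) (x : PreLocalization φ E) :
    rep φ T (x : Localization φ E) = PreLocalization.map φ T x := by
  simp [rep]

end Localization

section Orbit

variable {A : Type*} [CStarAlgebra A] [PartialOrder A] [StarOrderedRing A] {φ : A →ₚ[ℂ] ℂ}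
  {E : Type*} [NormedAddCommGroup E] [NormedSpace ℂ E] [Module Aᵐᵒᵖ E] [RightPreHilbertModule A E]

namespace PreLocalization

/-- The orbit map `a ↦ x a` of a vector `x`, from the pre-GNS space of `φ` to
`PreLocalization φ E`. -/
noncomputable def orbit (φ : A →ₚ[ℂ] ℂ) (x : E) : φ.PreGNS →L[ℂ] PreLocalization φ E :=
  LinearMap.mkContinuous
    { toFun := fun a => mk φ E (op (φ.ofPreGNS a) • x)
      map_add' := fun a b => by rw [map_add, op_add, add_smul, map_add]
      map_smul' := fun c a => congrArg (mk φ E) (smul_op_smul x (φ.ofPreGNS a) c).1.symm }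
    ‖x‖ fun a => by
    rw [← sq_le_sq₀ (norm_nonneg _) (by positivity), mul_pow, ← Complex.real_le_real]
    push_cast
    rw [norm_sq_eq, φ.preGNS_norm_sq, ← Complex.ofReal_pow]
    exact map_le_mul_map_of_le_smul φ (inner_op_smul_self_le x _)

theorem orbit_apply (x : E) (a : φ.PreGNS) : orbit φ x a = mk φ E (op (φ.ofPreGNS a) • x) := rfl

theorem norm_orbit_le (φ : A →ₚ[ℂ] ℂ) (x : E) : ‖orbit φ x‖ ≤ ‖x‖ :=
  LinearMap.mkContinuous_norm_le _ (norm_nonneg x) _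

end PreLocalization

namespace Localization

/-- The orbit map `a ↦ x a` of a vector `x`, from the GNS space of `φ` to the localization at
`φ`. -/
noncomputable def orbit (φ : A →ₚ[ℂ] ℂ) (x : E) : φ.GNS →L[ℂ] Localization φ E :=
  (PreLocalization.orbit φ x).completion

theorem orbit_apply_coe (x : E) (a : φ.PreGNS) :
    orbit φ x (a : φ.GNS) = PreLocalization.orbit φ x a :=
  completion_apply_coe _ a

theorem norm_orbit_le (φ : A →ₚ[ℂ] ℂ) (x : E) : ‖orbit φ x‖ ≤ ‖x‖ := by
  refine opNorm_le_bound _ (norm_nonneg x) fun z => ?_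
  induction z using Completion.induction_on with
  | hp => apply isClosed_le <;> fun_prop
  | ih a =>
    rw [orbit_apply_coe, Completion.norm_coe, Completion.norm_coe]
    exact le_of_opNorm_le _ (PreLocalization.norm_orbit_le φ x) a

theorem compression_orbit_rep [CompleteSpace E] (x : E) (T : adjointable A E) :
    compression (orbit φ x) (rep φ T) = φ.gnsStarAlgHom (vectorMap x T) := by
  refine ContinuousLinearMap.ext fun w => _root_.ext_inner_left ℂ fun z => ?_
  rw [compression_apply, comp_apply, adjoint_inner_right, comp_apply]
  induction z, w using Completion.induction_on₂ with
  | hp => apply isClosed_eq <;> fun_prop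
  | ih a b =>
    simp [orbit_apply_coe, rep_apply_coe, PreLocalization.orbit_apply, PreLocalization.map_apply,
      PreLocalization.inner_def, adjointable_apply_op_smul, inner_op_smul_left,
      inner_op_smul_right, φ.preGNS_inner_def, vectorMap_apply, mul_assoc]

end Localization

end Orbit

section Jensen

variable {A : Type u} {E : Type v} [CStarAlgebra A] [PartialOrder A] [StarOrderedRing A]
  [NormedAddCommGroup E] [NormedSpace ℂ E] [Module Aᵐᵒᵖ E] [RightPreHilbertModule A E]
  [CompleteSpace E] {J : Set ℝ} {f : ℝ → ℝ} {T : adjointable A E} {x : E}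

theorem spectrum_vectorMap_subset (hJ : J.OrdConnected) (h0 : 0 ∈ J) (hT : IsSelfAdjoint T)
    (hTJ : spectrum ℝ T ⊆ J) (hx : ‖x‖ ≤ 1) : spectrum ℝ (vectorMap x T) ⊆ J :=
  spectrum_map_subset_of_map_one_le _ (inner_self_le_one hx) hJ h0 hT hTJ

theorem cfc_gnsStarAlgHom_vectorMap_le (hJ : J.OrdConnected) (h0 : 0 ∈ J)
    (hf : OperatorConvexOn.{max u v} J f) (hf0 : f 0 ≤ 0) (hT : IsSelfAdjoint T)
    (hTJ : spectrum ℝ T ⊆ J) (hx : ‖x‖ ≤ 1) (φ : A →ₚ[ℂ] ℂ) :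
    cfc f (φ.gnsStarAlgHom (vectorMap x T)) ≤ φ.gnsStarAlgHom (vectorMap x (cfc f T)) := by
  have hrep : IsSelfAdjoint (Localization.rep φ T) := hT.map _
  have hrepJ : spectrum ℝ (Localization.rep φ T) ⊆ J :=
    (AlgHom.spectrum_apply_subset ((Localization.rep φ).restrictScalars ℝ) T).trans hTJ
  have hcfc : cfc f (Localization.rep φ T) = Localization.rep φ (cfc f T) :=
    (StarAlgHomClass.map_cfc (Localization.rep φ) f T (hf.1.mono hTJ) (map_continuous _) hT
      hrep).symm
  rw [← Localization.compression_orbit_rep, ← Localization.compression_orbit_rep, ← hcfc]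
  exact hf.cfc_compression_le_of_norm_le_one hJ h0 hf0
    ((Localization.norm_orbit_le φ x).trans hx) hrep hrepJ

theorem map_cfc_vectorMap_le (hJ : J.OrdConnected) (h0 : 0 ∈ J)
    (hf : OperatorConvexOn.{max u v} J f) (hf0 : f 0 ≤ 0) (hT : IsSelfAdjoint T)
    (hTJ : spectrum ℝ T ⊆ J) (hx : ‖x‖ ≤ 1) (φ : A →ₚ[ℂ] ℂ) :
    φ (cfc f (vectorMap x T)) ≤ φ (vectorMap x (cfc f T)) := by
  have hsa : IsSelfAdjoint (vectorMap x T) := hT.map' _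
  have hcont : ContinuousOn f (spectrum ℝ (vectorMap x T)) :=
    hf.1.mono (spectrum_vectorMap_subset hJ h0 hT hTJ hx)
  refine map_le_map_of_gnsStarAlgHom_le ?_
  rw [StarAlgHomClass.map_cfc φ.gnsStarAlgHom f _ hcont (map_continuous _) hsa (hsa.map _)]
  exact cfc_gnsStarAlgHom_vectorMap_le hJ h0 hf hf0 hT hTJ hx φ

end Jensen

end RightPreHilbertModule

end

theorem mainTheorem4 {A : Type u} {E : Type v}
    [CStarAlgebra A] [PartialOrder A] [StarOrderedRing A]
    [NormedAddCommGroup E] [NormedSpace ℂ E] [CompleteSpace E] [Module Aᵐᵒᵖ E]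
    [RightPreHilbertModule A E]
    (J : Set ℝ) (hJ : J.OrdConnected) (h0J : (0 : ℝ) ∈ J)
    (f : ℝ → ℝ) (hf : OperatorConvexOn.{max u v} J f) (hf0 : f 0 ≤ 0)
    (T : RightPreHilbertModule.adjointable A E) (hT : IsSelfAdjoint T) (hTJ : spectrum ℝ T ⊆ J)
    (x : E) (hx : ‖x‖ ≤ 1) :
    IsSelfAdjoint (inner A x ((T : E →L[ℂ] E) x)) ∧
      spectrum ℝ (inner A x ((T : E →L[ℂ] E) x)) ⊆ J ∧
      cfc f (inner A x ((T : E →L[ℂ] E) x)) ≤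
        inner A x (((cfc f T : RightPreHilbertModule.adjointable A E) : E →L[ℂ] E) x) :=
  ⟨hT.map' (RightPreHilbertModule.vectorMap x),
    RightPreHilbertModule.spectrum_vectorMap_subset hJ h0J hT hTJ hx,
    le_of_forall_positiveLinearMap_le IsSelfAdjoint.cfc
      (IsSelfAdjoint.cfc.map' (RightPreHilbertModule.vectorMap x))
      (RightPreHilbertModule.map_cfc_vectorMap_le hJ h0J hf hf0 hT hTJ hx)⟩
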